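/- Let $\mathscr U,\mathscr X,\mathscr Y$ be finite-dimensional real vector spaces, $m=\dim\mathscr U$, $p=\dim\mathscr Y$, and let $A:\mathscr X\to\mathscr X$, $B:\mathscr U\to\mathscr X$, $C:\mathscr X\to\mathscr Y$ be linear maps. For a system $x^+=Ax+B_vv$, $x(0)=x_0$, $y=Cx+E_vv$, fix one of the following meanings: (a) $x^+=\dot x$ on $[0,T]$, $T>0$, with continuous input signals; (b) $x^+=\dot x$ on $[0,T]$, $T>0$, with input signals in $L^r(0,T)$, $1\le r\le\infty$ (signals being identified when equal almost everywhere, solutions being absolutely continuous); (c) $x^+=x(k+1)$, $k=0,1,2,\dots$, with arbitrary input sequences. The system is called left-invertible with respect to $v$ if, for every $x_0\in\mathscr X$, two input signals that produce the same output signal from the initial state $x_0$ are equal. A subspace $\mathscr S\subseteq\mathscr X$ is an unobservability subspace if there are linear maps $L:\mathscr Y\to\mathscr X$ and $H:\mathscr Y\to\mathscr Y$ such that $\mathscr S$ is the largest $(A+LC)$-invariant subspace contained in $\ker HC$. **Theorem.** Assume that $(A,B)$ is controllable, that $(C,A)$ is observable, and that the system $x^+=Ax+Bu$, $y=Cx$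 is left-invertible with respect to $u$. Assume that the system is weakly output-redundant, that is, $\dim\operatorname{im}C=p>m$. Then there is a smallest unobservability subspace $\mathscr S^*$ containing $\operatorname{im}B$, and there exists a subspace $\mathscr D\ne0$ of $\mathscr Y$ with $\mathscr D\subseteq C\mathscr S^*$ such that, with $D:\mathscr D\to\mathscr Y$ the insertion map, the system $$x^+=Ax+Bu,\qquad y_d=Cx+Dd$$ is left-invertible with respect to the aggregate input $u_a=u\oplus d\in\mathscr U\oplus\mathscr D$. -/

import Mathlib

open MeasureTheory
open scoped ENNReal

/-! ### Invariant subspaces, controllability, observability, unobservability subspaces -/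

/-- `⟨A | 𝓑⟩`: the smallest `A`-invariant subspace that contains `𝓑`. -/
def smallestInvariant {X : Type*} [AddCommGroup X] [Module ℝ X]
    (A : X →ₗ[ℝ] X) (𝓑 : Submodule ℝ X) : Submodule ℝ X :=
  sInf {V | 𝓑 ≤ V ∧ ∀ x ∈ V, A x ∈ V}

/-- `⟨𝓚 | A⟩`: the largest `A`-invariant subspace that is contained in `𝓚`. -/
def largestInvariant {X : Type*} [AddCommGroup X] [Module ℝ X]
    (𝓚 : Submodule ℝ X) (A : X →ₗ[ℝ] X) : Submodule ℝ X :=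
  sSup {V | V ≤ 𝓚 ∧ ∀ x ∈ V, A x ∈ V}

/-- The pair `(A, B)` is controllable: `⟨A | im B⟩` is the whole state space. -/
def IsControllable {U X : Type*} [AddCommGroup U] [Module ℝ U] [AddCommGroup X] [Module ℝ X]
    (A : X →ₗ[ℝ] X) (B : U →ₗ[ℝ] X) : Prop :=
  smallestInvariant A (LinearMap.range B) = ⊤

/-- The pair `(C, A)` is observable: `⟨ker C | A⟩ = 0`. -/
def IsObservable {X Y : Type*} [AddCommGroup X] [Module ℝ X] [AddCommGroup Y] [Module ℝ Y]
    (C : X →ₗ[ℝ] Y) (A : X →ₗ[ℝ] X) : Prop :=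
  largestInvariant (LinearMap.ker C) A = ⊥

/-- `S` is an unobservability subspace: `S = ⟨ker (H C) | A + L C⟩` for some output-injection map
`L : Y → X` and some measurement mixing map `H : Y → Y`. -/
def IsUnobservabilitySubspace {X Y : Type*} [AddCommGroup X] [Module ℝ X]
    [AddCommGroup Y] [Module ℝ Y]
    (C : X →ₗ[ℝ] Y) (A : X →ₗ[ℝ] X) (S : Submodule ℝ X) : Prop :=
  ∃ (L : Y →ₗ[ℝ] X) (H : Y →ₗ[ℝ] Y), S = largestInvariant (LinearMap.ker (H ∘ₗ C)) (A + L ∘ₗ C)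

/-- `S` is the infimal element `𝓢*(C, A; 𝓑)` of the class of unobservability subspaces that
contain `𝓑`. -/
def IsInfimalUnobservabilitySubspace {X Y : Type*} [AddCommGroup X] [Module ℝ X]
    [AddCommGroup Y] [Module ℝ Y]
    (C : X →ₗ[ℝ] Y) (A : X →ₗ[ℝ] X) (𝓑 S : Submodule ℝ X) : Prop :=
  IsLeast {S' : Submodule ℝ X | IsUnobservabilitySubspace C A S' ∧ 𝓑 ≤ S'} S

/-! ### Trajectories and left-invertibility -/

/-- The meaning of `x⁺` together with the space of input signals:
* `continuous T`: `x⁺ = dx/dt` on `[0, T]`, continuous signals, equality at every time;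
* `lebesgue T r`: `x⁺ = dx/dt` on `[0, T]`, signals in `L^r(0, T)`, `1 ≤ r ≤ ∞`, equality
  almost everywhere;
* `discrete`: `x⁺ = x (k + 1)`, all sequences indexed by `k = 0, 1, 2, …`. -/
inductive SignalSetting : Type
  | continuous (T : ℝ) (hT : 0 < T) : SignalSetting
  | lebesgue (T : ℝ) (hT : 0 < T) (r : ℝ≥0∞) (hr : 1 ≤ r) : SignalSetting
  | discrete : SignalSetting

/-- `x` solves `dx/dt = A x + B v`, `x 0 = x₀` on `[0, T]` (in the Carathéodory sense; for
continuous `v` this is the classical sense). -/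
def IsContinuousTrajectory {V X : Type*} [NormedAddCommGroup V] [NormedSpace ℝ V]
    [NormedAddCommGroup X] [NormedSpace ℝ X]
    (A : X →ₗ[ℝ] X) (B : V →ₗ[ℝ] X) (T : ℝ) (x₀ : X) (v : ℝ → V) (x : ℝ → X) : Prop :=
  ContinuousOn x (Set.Icc 0 T) ∧
    ∀ t ∈ Set.Icc 0 T, x t = x₀ + ∫ τ in (0 : ℝ)..t, (A (x τ) + B (v τ))

/-- `x` solves `x (k + 1) = A (x k) + B (v k)`, `x 0 = x₀`. -/
def IsDiscreteTrajectory {V X : Type*} [AddCommGroup V] [Module ℝ V]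
    [AddCommGroup X] [Module ℝ X]
    (A : X →ₗ[ℝ] X) (B : V →ₗ[ℝ] X) (x₀ : X) (v : ℕ → V) (x : ℕ → X) : Prop :=
  x 0 = x₀ ∧ ∀ k, x (k + 1) = A (x k) + B (v k)

/-- Left-invertibility of the system `x⁺ = A x + B v`, `y = C x + E v` with respect to its input
`v`: for every initial condition, two input signals that produce the same output signal are
equal. -/
def LeftInvertible {V X Y : Type*} [NormedAddCommGroup V] [NormedSpace ℝ V]
    [NormedAddCommGroup X] [NormedSpace ℝ X] [NormedAddCommGroup Y] [NormedSpace ℝ Y]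
    (σ : SignalSetting)
    (C : X →ₗ[ℝ] Y) (A : X →ₗ[ℝ] X) (B : V →ₗ[ℝ] X) (E : V →ₗ[ℝ] Y) : Prop :=
  match σ with
  | .continuous T _ =>
      ∀ (x₀ : X) (v₁ v₂ : ℝ → V) (x₁ x₂ : ℝ → X),
        ContinuousOn v₁ (Set.Icc 0 T) → ContinuousOn v₂ (Set.Icc 0 T) →
        IsContinuousTrajectory A B T x₀ v₁ x₁ → IsContinuousTrajectory A B T x₀ v₂ x₂ →
        (∀ t ∈ Set.Icc 0 T, C (x₁ t) + E (v₁ t) = C (x₂ t) + E (v₂ t)) →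
        ∀ t ∈ Set.Icc 0 T, v₁ t = v₂ t
  | .lebesgue T _ r _ =>
      ∀ (x₀ : X) (v₁ v₂ : ℝ → V) (x₁ x₂ : ℝ → X),
        MemLp v₁ r (volume.restrict (Set.Icc 0 T)) → MemLp v₂ r (volume.restrict (Set.Icc 0 T)) →
        IsContinuousTrajectory A B T x₀ v₁ x₁ → IsContinuousTrajectory A B T x₀ v₂ x₂ →
        (∀ᵐ t ∂(volume.restrict (Set.Icc 0 T)),
          C (x₁ t) + E (v₁ t) = C (x₂ t) + E (v₂ t)) →
        ∀ᵐ t ∂(volume.restrict (Set.Icc 0 T)), v₁ t = v₂ t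
  | .discrete =>
      ∀ (x₀ : X) (v₁ v₂ : ℕ → V) (x₁ x₂ : ℕ → X),
        IsDiscreteTrajectory A B x₀ v₁ x₁ → IsDiscreteTrajectory A B x₀ v₂ x₂ →
        (∀ k, C (x₁ k) + E (v₁ k) = C (x₂ k) + E (v₂ k)) →
        ∀ k, v₁ k = v₂ k

/-- The system `x⁺ = A x + B u`, `y_d = C x + D d`, with `D : 𝓓 → Y` the insertion map of the
subspace `𝓓` of `Y`, is left-invertible with respect to the aggregate input
`u_a = u ⊕ d ∈ U ⊕ 𝓓`. -/
def LeftInvertibleAggregate {U X Y : Type*} [NormedAddCommGroup U] [NormedSpace ℝ U]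
    [NormedAddCommGroup X] [NormedSpace ℝ X] [NormedAddCommGroup Y] [NormedSpace ℝ Y]
    (σ : SignalSetting)
    (C : X →ₗ[ℝ] Y) (A : X →ₗ[ℝ] X) (B : U →ₗ[ℝ] X) (𝓓 : Submodule ℝ Y) : Prop :=
  LeftInvertible (V := U × 𝓓) σ C A
    (B ∘ₗ LinearMap.fst ℝ U 𝓓) (𝓓.subtype ∘ₗ LinearMap.snd ℝ U 𝓓)

/-- Weak output redundancy: `p = dim Y > m = dim U` and `dim (im C) = p`. -/
def WeaklyOutputRedundant (U : Type*) {X Y : Type*} [AddCommGroup U] [Module ℝ U]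
    [AddCommGroup X] [Module ℝ X] [AddCommGroup Y] [Module ℝ Y] (C : X →ₗ[ℝ] Y) : Prop :=
  Module.finrank ℝ U < Module.finrank ℝ Y ∧
    Module.finrank ℝ (LinearMap.range C) = Module.finrank ℝ Y

/-! One line spanned by a well-chosen vector `d` suffices for `𝓓`. Left-invertibility is equivalent
to the algebraic condition `HasNoOutputNullingInput`, in which the signal setting does not occur, so
everything can be decided in discrete time (`leftInvertible_iff_discrete`).

Let `W` be the smallest conditioned invariant subspace containing `im B`; it lies in every
unobservability subspace containing `im B`, so `C W ≤ C S*`. Left-invertibility makes `(u, w) ↦ B u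
+ A w` injective on `U × (W ∩ ker C)`, with values in `W`, whence `dim C W ≥ m`
(`LeftInvertible.finrank_le_finrank_map`). Choose independent `d₁, …, dₘ` in `C W`.

Suppose that every line `ℝ dᵢ` fails. Then each `dᵢ` carries a nonzero response `sᵢ dᵢ` of the
original system to some input `vᵢ`. The `m` inputs `vᵢ` together with any impulse are `m + 1`
elements of `U[[z]]`, hence dependent over `ℝ[[z]]`. Passing to outputs, a nonzero multiple of the
impulse response lies in the span of the `dᵢ`, so all Markov parameters do (`markov_mem_span`). By
controllability `im C` lies in that span as well, so `p ≤ m`, a contradiction. -/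

/-! ### Linear algebra preliminaries -/

section Preliminaries

variable {V X Y : Type*} [AddCommGroup V] [Module ℝ V] [AddCommGroup X] [Module ℝ X]
  [AddCommGroup Y] [Module ℝ Y]

/-- Every subspace is the kernel of an endomorphism. -/
theorem Submodule.exists_endomorphism_ker_eq (Q : Submodule ℝ X) :
    ∃ f : X →ₗ[ℝ] X, LinearMap.ker f = Q := by
  obtain ⟨q, hq⟩ := Q.exists_isCompl
  refine ⟨q.subtype ∘ₗ q.projectionOnto Q hq.symm, ?_⟩
  rw [LinearMap.ker_comp_of_ker_eq_bot _ q.ker_subtype, Submodule.ker_projectionOnto]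

/-- A linear relation that is total on a subspace contains the graph of a linear map there. -/
theorem Submodule.exists_linear_selection (W : Submodule ℝ X) (P : Submodule ℝ (X × V))
    (h : ∀ x ∈ W, ∃ v, (x, v) ∈ P) : ∃ F : X →ₗ[ℝ] V, ∀ x ∈ W, (x, F x) ∈ P := by
  let f : P →ₗ[ℝ] P.map (LinearMap.fst ℝ X V) := (LinearMap.fst ℝ X V).submoduleMap P
  obtain ⟨g, hg⟩ := f.exists_rightInverse_of_surjective
    (LinearMap.range_eq_top.2 ((LinearMap.fst ℝ X V).submoduleMap_surjective P))
  obtain ⟨F, hF⟩ := LinearMap.exists_extend (LinearMap.snd ℝ X V ∘ₗ P.subtype ∘ₗ g)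
  refine ⟨F, fun x hx => ?_⟩
  obtain ⟨v, hv⟩ := h x hx
  have hx' : x ∈ P.map (LinearMap.fst ℝ X V) := ⟨(x, v), hv, rfl⟩
  have h1 : F x = (g ⟨x, hx'⟩ : X × V).2 := LinearMap.congr_fun hF ⟨x, hx'⟩
  have h2 : (g ⟨x, hx'⟩ : X × V).1 = x :=
    congrArg Subtype.val (LinearMap.congr_fun hg ⟨x, hx'⟩)
  have h3 : (x, F x) = (g ⟨x, hx'⟩ : X × V) := Prod.ext h2.symm h1
  rw [h3]
  exact (g ⟨x, hx'⟩).2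

/-- The pairs `(x, v)` with `A x + B v ∈ W` and `C x + E v = 0`. -/
def outputNullingRelation (C : X →ₗ[ℝ] Y) (A : X →ₗ[ℝ] X) (B : V →ₗ[ℝ] X) (E : V →ₗ[ℝ] Y)
    (W : Submodule ℝ X) : Submodule ℝ (X × V) :=
  W.comap (A.coprod B) ⊓ LinearMap.ker (C.coprod E)

theorem mem_outputNullingRelation {C : X →ₗ[ℝ] Y} {A : X →ₗ[ℝ] X} {B : V →ₗ[ℝ] X}
    {E : V →ₗ[ℝ] Y} {W : Submodule ℝ X} {x : X} {v : V} :
    (x, v) ∈ outputNullingRelation C A B E W ↔ A x + B v ∈ W ∧ C x + E v = 0 := by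
  simp [outputNullingRelation]

/-- The subspace `W` can be made invariant by inputs that keep the output at zero. -/
def IsOutputNullingSubspace (C : X →ₗ[ℝ] Y) (A : X →ₗ[ℝ] X) (B : V →ₗ[ℝ] X) (E : V →ₗ[ℝ] Y)
    (W : Submodule ℝ X) : Prop :=
  ∀ x ∈ W, ∃ v, A x + B v ∈ W ∧ C x + E v = 0

theorem IsOutputNullingSubspace.exists_friend {C : X →ₗ[ℝ] Y} {A : X →ₗ[ℝ] X} {B : V →ₗ[ℝ] X}
    {E : V →ₗ[ℝ] Y} {W : Submodule ℝ X} (hW : IsOutputNullingSubspace C A B E W) :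
    ∃ F : X →ₗ[ℝ] V, ∀ x ∈ W, A x + B (F x) ∈ W ∧ C x + E (F x) = 0 := by
  obtain ⟨F, hF⟩ := W.exists_linear_selection (outputNullingRelation C A B E W) fun x hx => by
    simpa only [mem_outputNullingRelation] using hW x hx
  exact ⟨F, fun x hx => mem_outputNullingRelation.1 (hF x hx)⟩

/-- No nonzero input keeps both the output at zero and the state in an output-nulling subspace. -/
def HasNoOutputNullingInput (C : X →ₗ[ℝ] Y) (A : X →ₗ[ℝ] X) (B : V →ₗ[ℝ] X)
    (E : V →ₗ[ℝ] Y) : Prop :=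
  ∀ W, IsOutputNullingSubspace C A B E W → ∀ v, B v ∈ W → E v = 0 → v = 0

/-- The solution of `x (k + 1) = A (x k) + B (v k)` with `x 0 = 0`. -/
def discreteState (A : X →ₗ[ℝ] X) (B : V →ₗ[ℝ] X) (v : ℕ → V) : ℕ → X
  | 0 => 0
  | k + 1 => A (discreteState A B v k) + B (v k)

/-- The span of the states visited is itself output-nulling. Relative to a friend `F` of it, `v k -
F (x k)` is an input excluded by the hypothesis unless zero. So the input is state feedback, and the
closed loop started at zero stays there. -/
theorem HasNoOutputNullingInput.eq_zero_of_discrete {C : X →ₗ[ℝ] Y} {A : X →ₗ[ℝ] X}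
    {B : V →ₗ[ℝ] X} {E : V →ₗ[ℝ] Y} (hAlg : HasNoOutputNullingInput C A B E)
    {v : ℕ → V} {x : ℕ → X} (h : IsDiscreteTrajectory A B 0 v x)
    (hy : ∀ k, C (x k) + E (v k) = 0) (k : ℕ) : v k = 0 := by
  let W : Submodule ℝ X := Submodule.span ℝ (Set.range x)
  have hxW : ∀ k, x k ∈ W := fun k => Submodule.subset_span ⟨k, rfl⟩
  have hvel : ∀ k, A (x k) + B (v k) ∈ W := fun k => h.2 k ▸ hxW (k + 1)
  have hWQ : W ≤ (outputNullingRelation C A B E W).map (LinearMap.fst ℝ X V) :=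
    Submodule.span_le.2 (by
      rintro _ ⟨k, rfl⟩
      exact ⟨(x k, v k), mem_outputNullingRelation.2 ⟨hvel k, hy k⟩, rfl⟩)
  have hWnull : IsOutputNullingSubspace C A B E W := fun w hw => by
    obtain ⟨⟨w', u⟩, hu, rfl⟩ := hWQ hw
    exact ⟨u, mem_outputNullingRelation.1 hu⟩
  obtain ⟨F, hF⟩ := hWnull.exists_friend
  have hvF : ∀ k, v k = F (x k) := fun k => by
    obtain ⟨h3, h4⟩ := hF _ (hxW k)
    refine sub_eq_zero.1 (hAlg W hWnull _ ?_ ?_)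
    · simpa [add_sub_add_left_eq_sub] using W.sub_mem (hvel k) h3
    · rw [map_sub, ← add_sub_add_left_eq_sub _ _ (C (x k)), hy k, h4, sub_zero]
  have hx0 : ∀ k, x k = 0 := fun k => by
    induction k with
    | zero => exact h.1
    | succ k ih => rw [h.2, hvF, ih]; simp
  rw [hvF, hx0, map_zero]

end Preliminaries

/-! ### Linear differential equations -/

section Flow

variable {W : Type*} [NormedAddCommGroup W] [NormedSpace ℝ W] [FiniteDimensional ℝ W]

/-- Adjoining a constant coordinate equal to `1` makes the equation linear on `W × ℝ`, where the
exponential solves it. -/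
theorem exists_hasDerivAt_affine (M : W →ₗ[ℝ] W) (b : W) :
    ∃ z : ℝ → W, z 0 = 0 ∧ ∀ t, HasDerivAt z (M (z t) + b) t := by
  let N : (W × ℝ) →L[ℝ] (W × ℝ) :=
    LinearMap.toContinuousLinearMap
      ((M.coprod (LinearMap.toSpanSingleton ℝ W b)).prod 0)
  let w : ℝ → W × ℝ := fun t => NormedSpace.exp (t • N) (0, 1)
  have hN : ∀ p : W × ℝ, N p = (M p.1 + p.2 • b, 0) := fun p => rfl
  have hw : ∀ t, HasDerivAt w (N (w t)) t := fun t =>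
    (hasDerivAt_exp_smul_const' (𝕂 := ℝ) N t).clm_apply (hasDerivAt_const t _) |>.congr_deriv
      (by simp [w])
  have hw0 : w 0 = (0, 1) := by simp [w]
  have h2 : ∀ t, HasDerivAt (fun s => (w s).2) 0 t := fun t =>
    (ContinuousLinearMap.snd ℝ W ℝ).hasFDerivAt.comp_hasDerivAt t (hw t)
  have h1 : ∀ t, (w t).2 = 1 := fun t => by
    have := is_const_of_deriv_eq_zero (fun s => (h2 s).differentiableAt)
      (fun s => (h2 s).deriv) t 0
    simpa [hw0] using this
  refine ⟨fun t => (w t).1, by simp [hw0], fun t => ?_⟩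
  exact ((ContinuousLinearMap.fst ℝ W ℝ).hasFDerivAt.comp_hasDerivAt t (hw t)).congr_deriv
    (by simp [hN, h1])

theorem eqOn_zero_of_eq_integral {M : W →ₗ[ℝ] W} {T : ℝ} {x : ℝ → W}
    (hx : ContinuousOn x (Set.Icc 0 T))
    (h : ∀ t ∈ Set.Icc 0 T, x t = ∫ τ in (0 : ℝ)..t, M (x τ)) :
    ∀ t ∈ Set.Icc 0 T, x t = 0 := by
  rcases lt_or_ge T 0 with hT | hT
  · intro t ht
    exact absurd (ht.1.trans ht.2) (not_le.2 hT)
  let M' : W →L[ℝ] W := LinearMap.toContinuousLinearMap M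
  have hMx : ContinuousOn (fun t => M (x t)) (Set.Icc 0 T) := M'.continuous.comp_continuousOn hx
  -- Grönwall: `x` vanishes at `0` and its right derivative is bounded by `‖M'‖ ‖x‖`.
  refine eq_zero_of_abs_deriv_le_mul_abs_self_of_eq_zero_right (f' := fun t => M (x t))
    (K := ‖M'‖) hx (fun t ht => ?_) ?_ (fun t _ => M'.le_opNorm (x t))
  · have hint : IntervalIntegrable (fun t => M (x t)) volume 0 t :=
      (hMx.mono (Set.Icc_subset_Icc_right ht.2.le)).intervalIntegrable_of_Icc ht.1
    have hmem : Set.Icc 0 T ∈ nhdsWithin t (Set.Ici t) :=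
      Filter.mem_of_superset (Icc_mem_nhdsGE ht.2) (Set.Icc_subset_Icc_left ht.1)
    have hder : HasDerivWithinAt (fun s => ∫ τ in (0 : ℝ)..s, M (x τ)) (M (x t)) (Set.Ici t) t :=
      intervalIntegral.integral_hasDerivWithinAt_right hint
        (hMx.stronglyMeasurableAtFilter_nhdsWithin measurableSet_Icc t |>.filter_mono (by
          have : nhdsWithin t (Set.Ioi t) ≤ nhdsWithin t (Set.Ici t) :=
            nhdsWithin_mono _ Set.Ioi_subset_Ici_self
          exact this.trans (nhdsWithin_le_of_mem hmem)))
        (((hMx t ⟨ht.1, ht.2.le⟩).mono_of_mem_nhdsWithin hmem).mono Set.Ioi_subset_Ici_self)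
    refine hder.congr_of_eventuallyEq ?_ (h t ⟨ht.1, ht.2.le⟩)
    filter_upwards [hmem] with s hs using h s hs
  · simpa using h 0 ⟨le_rfl, hT⟩

end Flow

/-! ### Left-invertibility is independent of the signal setting -/

section Characterization

variable {V X Y : Type*} [NormedAddCommGroup V] [NormedSpace ℝ V] [FiniteDimensional ℝ V]
  [NormedAddCommGroup X] [NormedSpace ℝ X] [FiniteDimensional ℝ X]
  [NormedAddCommGroup Y] [NormedSpace ℝ Y]
  {C : X →ₗ[ℝ] Y} {A : X →ₗ[ℝ] X} {B : V →ₗ[ℝ] X} {E : V →ₗ[ℝ] Y}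

theorem LinearMap.intervalIntegrable_comp {W Z : Type*}
    [NormedAddCommGroup W] [NormedSpace ℝ W] [FiniteDimensional ℝ W]
    [NormedAddCommGroup Z] [NormedSpace ℝ Z] (L : W →ₗ[ℝ] Z)
    {f : ℝ → W} {a b : ℝ} (hf : IntervalIntegrable f volume a b) :
    IntervalIntegrable (fun t => L (f t)) volume a b :=
  ⟨(LinearMap.toContinuousLinearMap L).integrable_comp hf.1,
    (LinearMap.toContinuousLinearMap L).integrable_comp hf.2⟩

theorem intervalIntegrable_state_add_input {T : ℝ} (hT : 0 < T) {x : ℝ → X} {v : ℝ → V}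
    (hx : ContinuousOn x (Set.Icc 0 T)) (hv : IntegrableOn v (Set.Icc 0 T)) :
    IntervalIntegrable (fun τ => A (x τ) + B (v τ)) volume 0 T :=
  (A.intervalIntegrable_comp (hx.intervalIntegrable_of_Icc hT.le)).add
    (B.intervalIntegrable_comp
      ((intervalIntegrable_iff_integrableOn_Icc_of_le hT.le).2 hv))

theorem IsContinuousTrajectory.sub {T : ℝ} (hT : 0 < T) {x₀ : X} {v₁ v₂ : ℝ → V}
    {x₁ x₂ : ℝ → X} (hv₁ : IntegrableOn v₁ (Set.Icc 0 T)) (hv₂ : IntegrableOn v₂ (Set.Icc 0 T))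
    (h₁ : IsContinuousTrajectory A B T x₀ v₁ x₁) (h₂ : IsContinuousTrajectory A B T x₀ v₂ x₂) :
    IsContinuousTrajectory A B T 0 (v₁ - v₂) (x₁ - x₂) := by
  refine ⟨h₁.1.sub h₂.1, fun t ht => ?_⟩
  have hsub : Set.uIcc 0 t ⊆ Set.uIcc 0 T := by
    rw [Set.uIcc_of_le ht.1, Set.uIcc_of_le hT.le]
    exact Set.Icc_subset_Icc_right ht.2
  have e : (fun τ => A ((x₁ - x₂) τ) + B ((v₁ - v₂) τ)) =
      fun τ => (A (x₁ τ) + B (v₁ τ)) - (A (x₂ τ) + B (v₂ τ)) := by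
    funext τ
    simp only [Pi.sub_apply, map_sub]
    abel
  rw [e, intervalIntegral.integral_sub
    ((intervalIntegrable_state_add_input hT h₁.1 hv₁).mono_set hsub)
    ((intervalIntegrable_state_add_input hT h₂.1 hv₂).mono_set hsub),
    Pi.sub_apply, h₁.2 t ht, h₂.2 t ht]
  abel

/-- The velocity of a trajectory lies almost everywhere in each subspace containing the states. -/
theorem IsContinuousTrajectory.ae_velocity_mem {T : ℝ} (hT : 0 < T) {x₀ : X} {v : ℝ → V}
    {x : ℝ → X} (hv : IntegrableOn v (Set.Icc 0 T)) (h : IsContinuousTrajectory A B T x₀ v x)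
    {W : Submodule ℝ X} (hW : ∀ t ∈ Set.Icc 0 T, x t ∈ W) :
    ∀ᵐ t ∂(volume.restrict (Set.Icc 0 T)), A (x t) + B (v t) ∈ W := by
  -- Membership in `W` becomes the equation `P (x t) = 0`, which can be differentiated at almost
  -- every interior time.
  obtain ⟨P, hP⟩ := W.exists_endomorphism_ker_eq
  let P' : X →L[ℝ] X := LinearMap.toContinuousLinearMap P
  have hne : ∀ a : ℝ, ∀ᵐ t ∂volume, t ≠ a := fun a => by simp [ae_iff, measure_singleton]
  rw [ae_restrict_iff' measurableSet_Icc]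
  filter_upwards [(intervalIntegrable_state_add_input (A := A) (B := B) hT
    h.1 hv).ae_hasDerivAt_integral, hne 0, hne T] with t hd h0 h1 ht
  have hd' := hd (by rwa [Set.uIcc_of_le hT.le]) 0 (by simp)
  have hxd : HasDerivAt x (A (x t) + B (v t)) t := by
    refine (hd'.const_add x₀).congr_of_eventuallyEq ?_
    filter_upwards [Icc_mem_nhds (lt_of_le_of_ne ht.1 (Ne.symm h0)) (lt_of_le_of_ne ht.2 h1)]
      with s hs using h.2 s hs
  have hPd : HasDerivAt (fun s => P (x s)) (P (A (x t) + B (v t))) t :=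
    P'.hasFDerivAt.comp_hasDerivAt t hxd
  have hP0 : HasDerivAt (fun s => P (x s)) 0 t := by
    refine (hasDerivAt_const t (0 : X)).congr_of_eventuallyEq ?_
    filter_upwards [Icc_mem_nhds (lt_of_le_of_ne ht.1 (Ne.symm h0)) (lt_of_le_of_ne ht.2 h1)]
      with s hs
    have : x s ∈ LinearMap.ker P := hP ▸ hW s hs
    exact this
  rw [← hP]
  exact hPd.unique hP0

/-- The argument of `eq_zero_of_discrete` with equalities almost everywhere. -/
theorem HasNoOutputNullingInput.ae_eq_zero (hAlg : HasNoOutputNullingInput C A B E)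
    {T : ℝ} (hT : 0 < T) {v : ℝ → V} {x : ℝ → X} (hv : IntegrableOn v (Set.Icc 0 T))
    (h : IsContinuousTrajectory A B T 0 v x)
    (hy : ∀ᵐ t ∂(volume.restrict (Set.Icc 0 T)), C (x t) + E (v t) = 0) :
    ∀ᵐ t ∂(volume.restrict (Set.Icc 0 T)), v t = 0 := by
  let W : Submodule ℝ X := Submodule.span ℝ (x '' Set.Icc 0 T)
  have hxW : ∀ t ∈ Set.Icc 0 T, x t ∈ W := fun t ht => Submodule.subset_span ⟨t, ht, rfl⟩
  have hvel := h.ae_velocity_mem hT hv hxW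
  let Q : Submodule ℝ X := (outputNullingRelation C A B E W).map (LinearMap.fst ℝ X V)
  -- The relation holds only at almost every time, but `Q` is a kernel and `x` is continuous, so
  -- every state lies in `Q`. This is what makes the span `W` output-nulling.
  have hQ : ∀ t ∈ Set.Icc 0 T, x t ∈ Q := by
    obtain ⟨P, hP⟩ := Q.exists_endomorphism_ker_eq
    have hae : (fun t => P (x t)) =ᵐ[volume.restrict (Set.Icc 0 T)] fun _ => 0 := by
      filter_upwards [hvel, hy] with t h1 h2
      have : x t ∈ LinearMap.ker P :=
        hP ▸ ⟨(x t, v t), mem_outputNullingRelation.2 ⟨h1, h2⟩, rfl⟩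
      exact this
    intro t ht
    rw [← hP]
    exact Measure.eqOn_Icc_of_ae_eq volume hT.ne hae
      ((LinearMap.toContinuousLinearMap P).continuous.comp_continuousOn h.1)
      continuousOn_const ht
  have hWQ : W ≤ Q := Submodule.span_le.2 (by rintro _ ⟨t, ht, rfl⟩; exact hQ t ht)
  have hWnull : IsOutputNullingSubspace C A B E W := fun w hw => by
    obtain ⟨⟨w', u⟩, hu, rfl⟩ := hWQ hw
    exact ⟨u, mem_outputNullingRelation.1 hu⟩
  obtain ⟨F, hF⟩ := hWnull.exists_friend
  have hvF : ∀ᵐ t ∂(volume.restrict (Set.Icc 0 T)), v t = F (x t) := by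
    filter_upwards [hvel, hy, ae_restrict_mem measurableSet_Icc] with t h1 h2 ht
    obtain ⟨h3, h4⟩ := hF _ (hxW t ht)
    refine sub_eq_zero.1 (hAlg W hWnull _ ?_ ?_)
    · simpa [add_sub_add_left_eq_sub] using W.sub_mem h1 h3
    · rw [map_sub, ← add_sub_add_left_eq_sub _ _ (C (x t)), h2, h4, sub_zero]
  have hx0 : ∀ t ∈ Set.Icc 0 T, x t = 0 := by
    refine eqOn_zero_of_eq_integral (M := A + B ∘ₗ F) h.1 fun t ht => ?_
    rw [h.2 t ht, zero_add]
    refine intervalIntegral.integral_congr_ae ?_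
    rw [Set.uIoc_of_le ht.1]
    filter_upwards [(ae_restrict_iff' measurableSet_Icc).1 hvF] with s hs hmem
    simp [hs ⟨hmem.1.le, hmem.2.trans ht.2⟩]
  filter_upwards [hvF, ae_restrict_mem measurableSet_Icc] with t h1 ht
  rw [h1, hx0 t ht, map_zero]

theorem HasNoOutputNullingInput.leftInvertible (hAlg : HasNoOutputNullingInput C A B E)
    (σ : SignalSetting) : LeftInvertible σ C A B E := by
  have hcont : ∀ {T : ℝ} (_ : 0 < T) (x₀ : X) (v₁ v₂ : ℝ → V) (x₁ x₂ : ℝ → X),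
      IntegrableOn v₁ (Set.Icc 0 T) → IntegrableOn v₂ (Set.Icc 0 T) →
      IsContinuousTrajectory A B T x₀ v₁ x₁ → IsContinuousTrajectory A B T x₀ v₂ x₂ →
      (∀ᵐ t ∂(volume.restrict (Set.Icc 0 T)), C (x₁ t) + E (v₁ t) = C (x₂ t) + E (v₂ t)) →
      ∀ᵐ t ∂(volume.restrict (Set.Icc 0 T)), v₁ t = v₂ t := by
    intro T hT x₀ v₁ v₂ x₁ x₂ hv₁ hv₂ h₁ h₂ hy
    filter_upwards [hAlg.ae_eq_zero hT (hv₁.sub hv₂) (h₁.sub hT hv₁ hv₂ h₂) (by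
      filter_upwards [hy] with t ht
      simp only [Pi.sub_apply, map_sub]
      rw [← add_sub_add_comm, ht, sub_self])] with t ht
    exact sub_eq_zero.1 ht
  cases σ with
  | continuous T hT =>
    intro x₀ v₁ v₂ x₁ x₂ hv₁ hv₂ h₁ h₂ hy
    exact Measure.eqOn_Icc_of_ae_eq volume hT.ne
      (hcont hT x₀ v₁ v₂ x₁ x₂ hv₁.integrableOn_Icc hv₂.integrableOn_Icc h₁ h₂
        ((ae_restrict_iff' measurableSet_Icc).2 (Filter.Eventually.of_forall hy))) hv₁ hv₂
  | lebesgue T hT r hr =>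
    intro x₀ v₁ v₂ x₁ x₂ hv₁ hv₂ h₁ h₂ hy
    exact hcont hT x₀ v₁ v₂ x₁ x₂ (hv₁.integrable hr) (hv₂.integrable hr) h₁ h₂ hy
  | discrete =>
    intro x₀ v₁ v₂ x₁ x₂ h₁ h₂ hy k
    refine sub_eq_zero.1 (hAlg.eq_zero_of_discrete (v := v₁ - v₂) (x := x₁ - x₂)
      ⟨by simp [h₁.1, h₂.1], fun j => ?_⟩ (fun j => ?_) k)
    · simp only [Pi.sub_apply, map_sub, h₁.2, h₂.2]
      abel
    · simp only [Pi.sub_apply, map_sub]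
      rw [← add_sub_add_comm, hy, sub_self]

/-- An excluded input `v₀` gives a concrete failure of invertibility: the feedback `F` plus the
constant `v₀`, started at zero, stays in `W` with zero output, as the zero input does. At time zero
this input equals `v₀`. -/
theorem LeftInvertible.hasNoOutputNullingInput {σ : SignalSetting}
    (hli : LeftInvertible σ C A B E) : HasNoOutputNullingInput C A B E := by
  intro W hW v₀ hB hE
  obtain ⟨F, hF⟩ := hW.exists_friend
  let M : W →ₗ[ℝ] W := (A + B ∘ₗ F).restrict fun x hx => (hF x hx).1
  have hM : ∀ w : W, (M w : X) = A w + B (F w) := fun w => rfl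
  have hy : ∀ w : W, C (w : X) + E (F w + v₀) = C 0 + E 0 := fun w => by
    rw [map_add E, ← add_assoc, (hF w w.2).2, hE, map_zero, map_zero]
  obtain ⟨z, hz0, hz⟩ := exists_hasDerivAt_affine M ⟨B v₀, hB⟩
  have hzX : ∀ t, HasDerivAt (fun s => (z s : X)) (A (z t) + B (F (z t) + v₀)) t := fun t =>
    (W.subtypeL.hasFDerivAt.comp_hasDerivAt t (hz t)).congr_deriv (by
      simp [hM, add_assoc])
  have hzc : Continuous fun s => (z s : X) :=
    continuous_iff_continuousAt.2 fun t => (hzX t).continuousAt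
  have hvc : Continuous fun s => F (z s) + v₀ :=
    ((LinearMap.toContinuousLinearMap F).continuous.comp hzc).add continuous_const
  have hAB : Continuous fun s => A (z s) + B (F (z s) + v₀) :=
    ((LinearMap.toContinuousLinearMap A).continuous.comp hzc).add
      ((LinearMap.toContinuousLinearMap B).continuous.comp hvc)
  have htraj : ∀ T, IsContinuousTrajectory A B T 0 (fun s => F (z s) + v₀) fun s => (z s : X) :=
    fun T => ⟨hzc.continuousOn, fun t _ => by
      rw [intervalIntegral.integral_eq_sub_of_hasDerivAt (fun s _ => hzX s)
        (hAB.intervalIntegrable _ _), hz0]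
      simp⟩
  have htraj0 : ∀ T, IsContinuousTrajectory A B T 0 (fun _ => 0) fun _ => 0 :=
    fun T => ⟨continuousOn_const, by simp⟩
  have hend : F (z 0) + v₀ = 0 → v₀ = 0 := fun h => by simpa [hz0] using h
  cases σ with
  | continuous T hT =>
    exact hend (hli 0 _ _ _ _ hvc.continuousOn continuousOn_const (htraj T) (htraj0 T)
      (fun t _ => hy (z t)) 0 ⟨le_rfl, hT.le⟩)
  | lebesgue T hT r hr =>
    have hmem : MemLp (fun s => F (z s) + v₀) r (volume.restrict (Set.Icc 0 T)) := by
      obtain ⟨K, hK⟩ := isCompact_Icc.exists_bound_of_continuousOn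
        (hvc.continuousOn (s := Set.Icc 0 T))
      exact MemLp.of_bound hvc.aestronglyMeasurable K
        ((ae_restrict_iff' measurableSet_Icc).2 (Filter.Eventually.of_forall hK))
    exact hend (Measure.eqOn_Icc_of_ae_eq volume hT.ne
      (hli 0 _ _ _ _ hmem MemLp.zero' (htraj T) (htraj0 T)
        (Filter.Eventually.of_forall fun t => hy (z t)))
      hvc.continuousOn continuousOn_const ⟨le_rfl, hT.le⟩)
  | discrete =>
    let w : ℕ → W := discreteState M LinearMap.id fun _ => ⟨B v₀, hB⟩
    have hw : IsDiscreteTrajectory A B 0 (fun k => F (w k) + v₀) fun k => (w k : X) :=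
      ⟨rfl, fun k => by
        change (M (w k) : X) + B v₀ = _
        rw [hM, map_add B, add_assoc]⟩
    have hw0 : IsDiscreteTrajectory A B 0 (fun _ => 0) fun _ => 0 := ⟨rfl, by simp⟩
    simpa [w, discreteState] using hli 0 _ _ _ _ hw hw0 (fun k => hy (w k)) 0

theorem leftInvertible_iff_discrete (σ : SignalSetting) :
    LeftInvertible σ C A B E ↔ LeftInvertible .discrete C A B E :=
  ⟨fun h => h.hasNoOutputNullingInput.leftInvertible _,
    fun h => h.hasNoOutputNullingInput.leftInvertible _⟩

end Characterization

/-! ### Conditioned invariant and unobservability subspaces -/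

section ConditionedInvariant

variable {X Y : Type*} [AddCommGroup X] [Module ℝ X] [AddCommGroup Y] [Module ℝ Y]

theorem le_largestInvariant {𝓚 V : Submodule ℝ X} {A : X →ₗ[ℝ] X} (h : V ≤ 𝓚)
    (hA : ∀ x ∈ V, A x ∈ V) : V ≤ largestInvariant 𝓚 A :=
  le_sSup ⟨h, hA⟩

theorem largestInvariant_le (𝓚 : Submodule ℝ X) (A : X →ₗ[ℝ] X) : largestInvariant 𝓚 A ≤ 𝓚 :=
  sSup_le fun _ h => h.1

theorem map_mem_largestInvariant {𝓚 : Submodule ℝ X} {A : X →ₗ[ℝ] X} :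
    ∀ x ∈ largestInvariant 𝓚 A, A x ∈ largestInvariant 𝓚 A := by
  have : largestInvariant 𝓚 A ≤ (largestInvariant 𝓚 A).comap A :=
    sSup_le fun V h x hx => le_largestInvariant h.1 h.2 (h.2 x hx)
  exact this

/-- The subspace algorithm for the smallest conditioned invariant subspace containing `𝓑`. -/
def conditionedSeq (C : X →ₗ[ℝ] Y) (A : X →ₗ[ℝ] X) (𝓑 : Submodule ℝ X) : ℕ → Submodule ℝ X
  | 0 => ⊥
  | k + 1 => 𝓑 ⊔ (conditionedSeq C A 𝓑 k ⊓ LinearMap.ker C).map A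

/-- The smallest `(C, A)`-conditioned invariant subspace containing `𝓑`. -/
def minConditionedInvariant (C : X →ₗ[ℝ] Y) (A : X →ₗ[ℝ] X) (𝓑 : Submodule ℝ X) :
    Submodule ℝ X :=
  ⨆ k, conditionedSeq C A 𝓑 k

variable {C : X →ₗ[ℝ] Y} {A : X →ₗ[ℝ] X} {𝓑 : Submodule ℝ X}

theorem conditionedSeq_mono : Monotone (conditionedSeq C A 𝓑) := by
  refine monotone_nat_of_le_succ fun k => ?_
  induction k with
  | zero => exact bot_le
  | succ k ih => exact sup_le_sup_left (Submodule.map_mono (inf_le_inf_right _ ih)) _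

theorem mem_minConditionedInvariant {x : X} :
    x ∈ minConditionedInvariant C A 𝓑 ↔ ∃ k, x ∈ conditionedSeq C A 𝓑 k :=
  Submodule.mem_iSup_of_directed _ conditionedSeq_mono.directed_le

theorem le_minConditionedInvariant : 𝓑 ≤ minConditionedInvariant C A 𝓑 :=
  (le_sup_left : 𝓑 ≤ conditionedSeq C A 𝓑 1).trans (le_iSup (conditionedSeq C A 𝓑) 1)

theorem map_mem_minConditionedInvariant {x : X} (hx : x ∈ minConditionedInvariant C A 𝓑)
    (hC : C x = 0) : A x ∈ minConditionedInvariant C A 𝓑 := by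
  obtain ⟨k, hk⟩ := mem_minConditionedInvariant.1 hx
  exact mem_minConditionedInvariant.2
    ⟨k + 1, Submodule.mem_sup_right (Submodule.mem_map_of_mem ⟨hk, hC⟩)⟩

theorem minConditionedInvariant_le {S : Submodule ℝ X} (h𝓑 : 𝓑 ≤ S)
    (hS : ∀ x ∈ S, C x = 0 → A x ∈ S) : minConditionedInvariant C A 𝓑 ≤ S := by
  refine iSup_le fun k => ?_
  induction k with
  | zero => exact bot_le
  | succ k ih =>
    refine sup_le h𝓑 ?_
    rintro _ ⟨x, hx, rfl⟩
    exact hS x (ih hx.1) hx.2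

/-- A conditioned invariant subspace is made invariant by an output injection. -/
theorem exists_outputInjection {W : Submodule ℝ X} (hW : ∀ x ∈ W, C x = 0 → A x ∈ W) :
    ∃ L : Y →ₗ[ℝ] X, ∀ x ∈ W, (A + L ∘ₗ C) x ∈ W := by
  -- `s` is a linear section of `C` over `C W` with values in `W`. With `L = -A s` the vector `x`
  -- goes to `A (x - s (C x))`, and `x - s (C x)` lies in `W ∩ ker C`.
  obtain ⟨s, hs⟩ := (W.map C).exists_linear_selection
    (W.comap (LinearMap.snd ℝ Y X) ⊓
      LinearMap.ker (LinearMap.fst ℝ Y X - C ∘ₗ LinearMap.snd ℝ Y X)) (by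
        rintro _ ⟨w, hw, rfl⟩
        exact ⟨w, by simpa using hw⟩)
  refine ⟨-(A ∘ₗ s), fun x hx => ?_⟩
  obtain ⟨h1, h2⟩ := hs (C x) ⟨x, hx, rfl⟩
  have h3 : C x - C (s (C x)) = 0 := h2
  have := hW (x - s (C x)) (W.sub_mem hx h1) (by rw [map_sub, h3])
  simpa [sub_eq_add_neg] using this

theorem IsUnobservabilitySubspace.map_mem {S : Submodule ℝ X}
    (hS : IsUnobservabilitySubspace C A S) {x : X} (hx : x ∈ S) (hC : C x = 0) : A x ∈ S := by
  obtain ⟨L, H, rfl⟩ := hS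
  simpa [hC] using map_mem_largestInvariant x hx

theorem IsUnobservabilitySubspace.minConditionedInvariant_le {S : Submodule ℝ X}
    (hS : IsUnobservabilitySubspace C A S) (h𝓑 : 𝓑 ≤ S) : minConditionedInvariant C A 𝓑 ≤ S :=
  _root_.minConditionedInvariant_le h𝓑 fun _ => hS.map_mem

/-- The candidate `S` uses an `L` that keeps `W` invariant and an `H` with kernel `C W`. For a
competitor `S'`, the sum `S ⊔ S'` satisfies the constraints that define `S'` as largest, so it lies
in `S'`. -/
theorem exists_isInfimalUnobservabilitySubspace (C : X →ₗ[ℝ] Y) (A : X →ₗ[ℝ] X)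
    (𝓑 : Submodule ℝ X) : ∃ S, IsInfimalUnobservabilitySubspace C A 𝓑 S := by
  set W := minConditionedInvariant C A 𝓑
  obtain ⟨L, hL⟩ := exists_outputInjection (C := C) (A := A) (W := W)
    fun _ => map_mem_minConditionedInvariant
  obtain ⟨H, hH⟩ := (W.map C).exists_endomorphism_ker_eq
  have hker : ∀ x, x ∈ LinearMap.ker (H ∘ₗ C) ↔ C x ∈ W.map C := fun x => by
    rw [← hH]; rfl
  have hWS : W ≤ largestInvariant (LinearMap.ker (H ∘ₗ C)) (A + L ∘ₗ C) :=
    le_largestInvariant (fun x hx => (hker x).2 ⟨x, hx, rfl⟩) hL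
  refine ⟨largestInvariant (LinearMap.ker (H ∘ₗ C)) (A + L ∘ₗ C), ⟨⟨L, H, rfl⟩,
    le_minConditionedInvariant.trans hWS⟩, ?_⟩
  rintro S' ⟨hS', h𝓑⟩
  have hWS' : W ≤ S' := hS'.minConditionedInvariant_le h𝓑
  obtain ⟨L', H', rfl⟩ := hS'
  set S := largestInvariant (LinearMap.ker (H ∘ₗ C)) (A + L ∘ₗ C)
  set S' := largestInvariant (LinearMap.ker (H' ∘ₗ C)) (A + L' ∘ₗ C)
  refine le_sup_left.trans (le_largestInvariant (V := S ⊔ S') (sup_le (fun x hx => ?_)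
    (largestInvariant_le _ _)) fun x hx => ?_)
  · obtain ⟨w, hw, hwx⟩ := (hker x).1 (largestInvariant_le _ _ hx)
    have hw' : w ∈ LinearMap.ker (H' ∘ₗ C) := largestInvariant_le _ _ (hWS' hw)
    change H' (C x) = 0
    rw [← hwx]
    exact hw'
  · have : S ⊔ S' ≤ (S ⊔ S').comap (A + L' ∘ₗ C) := by
      refine sup_le (fun s hs => ?_)
        fun s hs => Submodule.mem_sup_right (map_mem_largestInvariant s hs)
      obtain ⟨w, hw, hws⟩ := (hker s).1 (largestInvariant_le _ _ hs)
      -- Since `C s = C w`, both injections act as `A` on `s - w`; hence `L'` can be traded for `L`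
      -- there, at the cost of a term in `S'`.
      have e : (A + L' ∘ₗ C) s =
          (A + L ∘ₗ C) s - (A + L ∘ₗ C) w + (A + L' ∘ₗ C) w := by
        simp [hws, sub_add_cancel, ← add_assoc]
      change (A + L' ∘ₗ C) s ∈ S ⊔ S'
      rw [e]
      exact add_mem (Submodule.mem_sup_left (sub_mem (map_mem_largestInvariant s hs)
        (hWS (hL w hw)))) (Submodule.mem_sup_right (map_mem_largestInvariant w (hWS' hw)))
    exact this hx

end ConditionedInvariant

/-! ### Discrete-time responses from the zero state -/

section DiscreteState

variable {V X Y : Type*} [AddCommGroup V] [Module ℝ V] [AddCommGroup X] [Module ℝ X]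

variable {A : X →ₗ[ℝ] X} {B : V →ₗ[ℝ] X}

theorem isDiscreteTrajectory_discreteState (v : ℕ → V) :
    IsDiscreteTrajectory A B 0 v (discreteState A B v) :=
  ⟨rfl, fun _ => rfl⟩

theorem IsDiscreteTrajectory.eq_discreteState {v : ℕ → V} {x : ℕ → X}
    (h : IsDiscreteTrajectory A B 0 v x) : x = discreteState A B v := by
  funext k
  induction k with
  | zero => exact h.1
  | succ k ih => rw [h.2, ih]; rfl

theorem discreteState_congr {v w : ℕ → V} {k : ℕ} (h : ∀ j < k, v j = w j) :
    discreteState A B v k = discreteState A B w k := by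
  induction k with
  | zero => rfl
  | succ k ih =>
    rw [discreteState, discreteState, ih fun j hj => h j (hj.trans k.lt_succ_self),
      h k k.lt_succ_self]

theorem discreteState_eq_zero {v : ℕ → V} (h : ∀ k, v k = 0) (k : ℕ) :
    discreteState A B v k = 0 := by
  induction k with
  | zero => rfl
  | succ k ih => simp [discreteState, ih, h]

theorem discreteState_sum {ι : Type*} (s : Finset ι) (v : ι → ℕ → V) (k : ℕ) :
    discreteState A B (fun j => ∑ i ∈ s, v i j) k = ∑ i ∈ s, discreteState A B (v i) k := by
  induction k with
  | zero => simp [discreteState]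
  | succ k ih => simp [discreteState, ih, Finset.sum_add_distrib]

theorem discreteState_single_succ (u : V) (k : ℕ) :
    discreteState A B (Pi.single 0 u) (k + 1) = (A ^ k) (B u) := by
  induction k with
  | zero => simp [discreteState]
  | succ k ih =>
    rw [discreteState, ih, pow_succ']
    simp

theorem discreteState_comp {U : Type*} [AddCommGroup U] [Module ℝ U] (L : U →ₗ[ℝ] V)
    (v : ℕ → U) (k : ℕ) :
    discreteState A (B ∘ₗ L) v k = discreteState A B (fun j => L (v j)) k := by
  induction k with
  | zero => rfl
  | succ k ih => rw [discreteState, discreteState, ih]; rfl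

/-- Dynamical meaning of the algorithm: its `k`-th term consists of states reachable from zero at
time `k` with output zero at all times before `k`. -/
theorem exists_discreteState_of_mem_conditionedSeq [AddCommGroup Y] [Module ℝ Y]
    {C : X →ₗ[ℝ] Y} {k : ℕ} {x : X}
    (hx : x ∈ conditionedSeq C A (LinearMap.range B) k) :
    ∃ v, discreteState A B v k = x ∧ ∀ j < k, C (discreteState A B v j) = 0 := by
  induction k generalizing x with
  | zero => exact ⟨0, ((Submodule.mem_bot ℝ).1 hx).symm, by simp⟩
  | succ k ih =>
    obtain ⟨_, ⟨u, rfl⟩, _, ⟨w, hw, rfl⟩, rfl⟩ := Submodule.mem_sup.1 hx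
    obtain ⟨v, hv, hv0⟩ := ih hw.1
    have hupd : ∀ j ≤ k, discreteState A B (Function.update v k u) j = discreteState A B v j :=
      fun j hj => discreteState_congr fun i hi =>
        Function.update_of_ne (hi.trans_le hj).ne _ _
    -- The input at time `k` first affects the state at time `k + 1`, so it can be replaced freely.
    refine ⟨Function.update v k u, ?_, fun j hj => ?_⟩
    · rw [discreteState, hupd k le_rfl, hv, Function.update_self, add_comm]
    · rw [hupd j (Nat.lt_succ_iff.1 hj)]
      rcases (Nat.lt_succ_iff.1 hj).lt_or_eq with h | rfl
      · exact hv0 j h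
      · rw [hv]; exact hw.2

end DiscreteState

/-! ### Discrete left-invertibility and the dimension of the image of `minConditionedInvariant` -/

section DiscreteLeftInvertible

variable {V X Y : Type*} [NormedAddCommGroup V] [NormedSpace ℝ V]
  [NormedAddCommGroup X] [NormedSpace ℝ X] [NormedAddCommGroup Y] [NormedSpace ℝ Y]
  {C : X →ₗ[ℝ] Y} {A : X →ₗ[ℝ] X} {B : V →ₗ[ℝ] X} {E : V →ₗ[ℝ] Y}

theorem leftInvertible_discrete_iff : LeftInvertible .discrete C A B E ↔
    ∀ v, (∀ k, C (discreteState A B v k) + E (v k) = 0) → ∀ k, v k = 0 := by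
  constructor
  · intro h v hv
    exact h 0 v (fun _ => 0) _ (fun _ => 0) (isDiscreteTrajectory_discreteState v)
      ⟨rfl, by simp⟩ (by simpa using hv)
  · intro h x₀ v₁ v₂ x₁ x₂ h₁ h₂ hy k
    have hsub : IsDiscreteTrajectory A B 0 (v₁ - v₂) (x₁ - x₂) :=
      ⟨by simp [h₁.1, h₂.1], fun j => by
        simp only [Pi.sub_apply, map_sub, h₁.2, h₂.2]
        abel⟩
    refine sub_eq_zero.1 (h (v₁ - v₂) (fun j => ?_) k)
    rw [← hsub.eq_discreteState]
    simp only [Pi.sub_apply, map_sub]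
    rw [← add_sub_add_comm, hy, sub_self]

theorem LeftInvertible.eq_zero_of_mem_minConditionedInvariant
    (hli : LeftInvertible .discrete C A B 0) {w : X} {u : V}
    (hw : w ∈ minConditionedInvariant C A (LinearMap.range B)) (hC : C w = 0)
    (h : B u + A w = 0) : u = 0 ∧ w = 0 := by
  obtain ⟨k, hk⟩ := mem_minConditionedInvariant.1 hw
  obtain ⟨v, hv, hv0⟩ := exists_discreteState_of_mem_conditionedSeq hk
  -- Steer to `w` at time `k` with zero output, apply `u` to land at `A w + B u = 0`, then rest. The
  -- output vanishes throughout, so the whole input must vanish, and with it `u` and the state `w`.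
  let v' : ℕ → V := fun j => if j < k then v j else if j = k then u else 0
  have h1 : ∀ j ≤ k, discreteState A B v' j = discreteState A B v j := fun j hj =>
    discreteState_congr fun i hi => if_pos (hi.trans_le hj)
  have h2 : ∀ j, discreteState A B v' (k + 1 + j) = 0 := fun j => by
    induction j with
    | zero =>
      rw [add_zero, discreteState, h1 k le_rfl, hv, add_comm]
      simpa [v'] using h
    | succ j ih =>
      have hj : v' (k + 1 + j) = 0 := by
        simp only [v']
        rw [if_neg (by omega), if_neg (by omega)]
      rw [← add_assoc, discreteState, ih, hj]
      simp
  have h3 := leftInvertible_discrete_iff.1 hli v' fun j => by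
    rw [LinearMap.zero_apply, add_zero]
    rcases lt_trichotomy j k with hj | rfl | hj
    · rw [h1 j hj.le, hv0 j hj]
    · rw [h1 j le_rfl, hv, hC]
    · obtain ⟨i, rfl⟩ := Nat.exists_eq_add_of_le (Nat.succ_le_of_lt hj)
      rw [h2, map_zero]
  refine ⟨by simpa [v'] using h3 k, ?_⟩
  rw [← hv, ← h1 k le_rfl, discreteState_eq_zero h3]

theorem LeftInvertible.finrank_le_finrank_map [FiniteDimensional ℝ X]
    [FiniteDimensional ℝ V] (hli : LeftInvertible .discrete C A B 0) :
    Module.finrank ℝ V ≤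
      Module.finrank ℝ ((minConditionedInvariant C A (LinearMap.range B)).map C) := by
  set W := minConditionedInvariant C A (LinearMap.range B)
  let K := LinearMap.ker (C.domRestrict W)
  -- Injectivity of `f` gives `dim V + dim K ≤ dim W`; rank-nullity for `C` on `W` then cancels `dim
  -- K`.
  let f : V × K →ₗ[ℝ] W :=
    (B.coprod (A ∘ₗ W.subtype ∘ₗ K.subtype)).codRestrict W fun p =>
      add_mem (le_minConditionedInvariant ⟨p.1, rfl⟩)
        (map_mem_minConditionedInvariant p.2.1.2 p.2.2)
  have hf : Function.Injective f := by
    refine (injective_iff_map_eq_zero f).2 fun p hp => ?_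
    have h0 : B p.1 + A p.2 = 0 := congrArg Subtype.val hp
    obtain ⟨h1, h2⟩ := hli.eq_zero_of_mem_minConditionedInvariant p.2.1.2 p.2.2 h0
    exact Prod.ext h1 (Subtype.ext (Subtype.ext h2))
  have h1 := LinearMap.finrank_le_finrank_of_injective hf
  have h2 := LinearMap.finrank_range_add_finrank_ker (C.domRestrict W)
  rw [LinearMap.range_domRestrict] at h2
  rw [Module.finrank_prod] at h1
  change Module.finrank ℝ V + Module.finrank ℝ (LinearMap.ker (C.domRestrict W)) ≤ _ at h1
  omega

end DiscreteLeftInvertible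

/-! ### Convolution of sequences with power series -/

section Convolution

variable {V X Y : Type*} [AddCommGroup V] [Module ℝ V] [AddCommGroup X] [Module ℝ X]
  [AddCommGroup Y] [Module ℝ Y]

/-- The action of a power series on a vector-valued sequence by convolution. -/
noncomputable def convolve (a : PowerSeries ℝ) (x : ℕ → X) (k : ℕ) : X :=
  ∑ p ∈ Finset.HasAntidiagonal.antidiagonal k, PowerSeries.coeff p.1 a • x p.2

theorem map_convolve (L : X →ₗ[ℝ] Y) (a : PowerSeries ℝ) (x : ℕ → X) (k : ℕ) :
    L (convolve a x k) = convolve a (fun j => L (x j)) k := by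
  simp [convolve]

theorem convolve_zero_left (x : ℕ → X) (k : ℕ) : convolve 0 x k = 0 := by
  simp [convolve]

theorem convolve_smul_const (a : PowerSeries ℝ) (s : ℕ → ℝ) (y : Y) (k : ℕ) :
    convolve a (fun j => s j • y) k = PowerSeries.coeff k (a * PowerSeries.mk s) • y := by
  simp [convolve, PowerSeries.coeff_mul, Finset.sum_smul, mul_smul]

theorem convolve_eq_coeff_mul (a : PowerSeries ℝ) (s : ℕ → ℝ) (k : ℕ) :
    convolve a s k = PowerSeries.coeff k (a * PowerSeries.mk s) := by
  simp [convolve, PowerSeries.coeff_mul]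

theorem eq_zero_of_convolve_eq_zero {a : PowerSeries ℝ} (ha : a ≠ 0) {s : ℕ → ℝ}
    (h : ∀ k, convolve a s k = 0) (k : ℕ) : s k = 0 := by
  have h0 : a * PowerSeries.mk s = 0 := by
    ext j
    rw [← convolve_eq_coeff_mul, h, map_zero]
  have := congrArg (PowerSeries.coeff k) ((mul_eq_zero.1 h0).resolve_left ha)
  simpa using this

theorem discreteState_convolve {A : X →ₗ[ℝ] X} {B : V →ₗ[ℝ] X} (a : PowerSeries ℝ)
    (v : ℕ → V) (k : ℕ) :
    discreteState A B (convolve a v) k = convolve a (discreteState A B v) k := by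
  induction k with
  | zero => simp [discreteState, convolve]
  | succ k ih =>
    -- The term split off at `k + 1` pairs a coefficient with the state at time `0`, which is zero.
    rw [discreteState, ih, map_convolve, map_convolve, convolve, convolve, convolve,
      Finset.Nat.sum_antidiagonal_succ', ← Finset.sum_add_distrib]
    simp [discreteState]

/-- More sequences than the dimension are linearly dependent over power series. -/
theorem exists_convolve_relation [FiniteDimensional ℝ V] {ι : Type*} [Fintype ι]
    (h : Module.finrank ℝ V < Fintype.card ι) (v : ι → ℕ → V) :
    ∃ g : ι → PowerSeries ℝ, (∃ i, g i ≠ 0) ∧ ∀ k, ∑ i, convolve (g i) (v i) k = 0 := by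
  let b := Module.finBasis ℝ V
  -- In coordinates the sequences are vectors of a free `ℝ[[z]]`-module of rank `dim V`, and
  -- convolution is scalar multiplication.
  let w : ι → Fin (Module.finrank ℝ V) → PowerSeries ℝ :=
    fun i j => PowerSeries.mk fun k => b.coord j (v i k)
  have hw : ¬ LinearIndependent (PowerSeries ℝ) w := fun hli => by
    have := hli.fintype_card_le_finrank
    rw [Module.finrank_fin_fun] at this
    omega
  obtain ⟨g, hg, hi⟩ := Fintype.not_linearIndependent_iff.1 hw
  refine ⟨g, hi, fun k => b.ext_elem fun j => ?_⟩
  have h1 := congrArg (PowerSeries.coeff k) (congrFun hg j)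
  rw [Finset.sum_apply, Pi.zero_apply, map_zero, map_sum] at h1
  rw [map_zero, Finsupp.zero_apply, ← h1, ← Module.Basis.coord_apply, map_sum]
  refine Finset.sum_congr rfl fun i _ => ?_
  rw [map_convolve, convolve_eq_coeff_mul]
  rfl

end Convolution

/-! ### Redundant outputs -/

section Redundancy

variable {U X Y : Type*} [NormedAddCommGroup U] [NormedSpace ℝ U]
  [NormedAddCommGroup X] [NormedSpace ℝ X] [NormedAddCommGroup Y] [NormedSpace ℝ Y]
  {C : X →ₗ[ℝ] Y} {A : X →ₗ[ℝ] X} {B : U →ₗ[ℝ] X}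

/-- If every direction `d i` carries a nonzero output response, and there are as many directions
as inputs, then all Markov parameters have their range in the span of the directions. -/
theorem markov_mem_span [FiniteDimensional ℝ U]
    {d : Fin (Module.finrank ℝ U) → Y} (hd : LinearIndependent ℝ d)
    {v : Fin (Module.finrank ℝ U) → ℕ → U} {s : Fin (Module.finrank ℝ U) → ℕ → ℝ}
    (hs : ∀ i, ∃ k, s i k ≠ 0) (hy : ∀ i k, C (discreteState A B (v i) k) = s i k • d i)
    (u : U) (k : ℕ) : C ((A ^ k) (B u)) ∈ Submodule.span ℝ (Set.range d) := by
  -- The index `none` carries the impulse `u` at time `0`, which makes one sequence more than `dim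
  -- U`.
  obtain ⟨g, ⟨i₀, hi₀⟩, hg⟩ := exists_convolve_relation
    (ι := Option (Fin (Module.finrank ℝ U))) (by simp)
    (fun i => i.elim (Pi.single 0 u) v)
  have hstate : ∀ j, convolve (g none) (fun l => C (discreteState A B (Pi.single 0 u) l)) j +
      ∑ i, PowerSeries.coeff j (g (some i) * PowerSeries.mk (s i)) • d i = 0 := fun j => by
    have h0 := discreteState_eq_zero (A := A) (B := B) hg j
    rw [discreteState_sum, Fintype.sum_option] at h0
    have h1 := congrArg C h0
    rw [map_add, map_sum, map_zero] at h1
    have e : ∀ (a : PowerSeries ℝ) (v : ℕ → U), C (discreteState A B (fun j => convolve a v j) j) =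
        convolve a (fun l => C (discreteState A B v l)) j := fun a v => by
      rw [← map_convolve, ← discreteState_convolve]
    simp only [e, Option.elim_none, Option.elim_some, hy, convolve_smul_const] at h1
    exact h1
  -- Without the impulse term, independence of the `d i` gives `g (some i) * s i = 0`. As `ℝ[[z]]`
  -- is a domain and `s i ≠ 0`, the relation would be trivial.
  have hnone : g none ≠ 0 := fun h => by
    have hsome : ∀ i, g (some i) = 0 := fun i => by
      have hmul : g (some i) * PowerSeries.mk (s i) = 0 := by
        ext j
        have h1 := hstate j
        rw [h, convolve_zero_left, zero_add] at h1
        exact Fintype.linearIndependent_iff.1 hd _ h1 i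
      refine (mul_eq_zero.1 hmul).resolve_right fun h0 => ?_
      obtain ⟨l, hl⟩ := hs i
      exact hl (by simpa using congrArg (PowerSeries.coeff l) h0)
    cases i₀ with
    | none => exact hi₀ h
    | some i => exact hi₀ (hsome i)
  by_contra hmem
  -- A functional that kills all `d i` leaves `g none` times the scalar impulse response equal to
  -- zero, so that response vanishes; its value at time `k + 1` is the Markov parameter with `A ^
  -- k`.
  obtain ⟨f, hf, hspan⟩ := Submodule.exists_le_ker_of_notMem hmem
  have hfd : ∀ i, f (d i) = 0 := fun i => hspan (Submodule.subset_span ⟨i, rfl⟩)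
  refine hf ?_
  rw [← discreteState_single_succ]
  refine eq_zero_of_convolve_eq_zero hnone
    (s := fun l => f (C (discreteState A B (Pi.single 0 u) l))) (fun j => ?_) (k + 1)
  have h1 := congrArg f (hstate j)
  simpa [map_convolve, hfd] using h1

theorem IsControllable.map_mem_of_markov_mem (hctrl : IsControllable A B) {𝒲 : Submodule ℝ Y}
    (h : ∀ u k, C ((A ^ k) (B u)) ∈ 𝒲) (x : X) : C x ∈ 𝒲 := by
  -- `K` is `A`-invariant and contains `im B`, so controllability makes it the whole space; `k = 0`
  -- is the claim.
  let K : Submodule ℝ X := ⨅ k : ℕ, 𝒲.comap (C ∘ₗ A ^ k)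
  have hK : ∀ x, x ∈ K ↔ ∀ k : ℕ, C ((A ^ k) x) ∈ 𝒲 := fun x => by simp [K]
  have hle : smallestInvariant A (LinearMap.range B) ≤ K := by
    refine sInf_le ⟨?_, fun x hx => (hK _).2 fun k => ?_⟩
    · rintro _ ⟨u, rfl⟩
      exact (hK _).2 (h u)
    · simpa [pow_succ] using (hK x).1 hx (k + 1)
  have hx : x ∈ K := hle (by rw [hctrl]; trivial)
  simpa using (hK x).1 hx 0

/-- A failure of left-invertibility of the aggregate system is witnessed by an input of the
original system whose output is nonzero and stays in the direction `d`. -/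
theorem exists_response_of_not_leftInvertibleAggregate (hli : LeftInvertible .discrete C A B 0)
    {d : Y} (h : ¬ LeftInvertibleAggregate .discrete C A B (Submodule.span ℝ {d})) :
    ∃ (v : ℕ → U) (s : ℕ → ℝ), (∃ k, s k ≠ 0) ∧
      ∀ k, C (discreteState A B v k) = s k • d := by
  rw [LeftInvertibleAggregate, leftInvertible_discrete_iff] at h
  push Not at h
  obtain ⟨w, hw, k₀, hk₀⟩ := h
  choose s hs using fun k => Submodule.mem_span_singleton.1 (w k).2.2
  have hy : ∀ k, C (discreteState A B (fun j => (w j).1) k) = (-s k) • d := fun k => by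
    have := hw k
    rw [discreteState_comp] at this
    rw [neg_smul, hs]
    exact eq_neg_of_add_eq_zero_left this
  refine ⟨fun j => (w j).1, fun k => -s k, ?_, hy⟩
  -- If the `d`-component vanished identically, the `u`-component would have zero output and vanish
  -- too, making the aggregate input zero.
  by_contra! h0
  have h1 := leftInvertible_discrete_iff.1 hli (fun j => (w j).1) fun k => by
    rw [hy, h0]; simp
  refine hk₀ (Prod.ext (h1 k₀) (Subtype.ext ?_))
  rw [← hs, neg_eq_zero.1 (h0 k₀), zero_smul]
  rfl

end Redundancy

theorem mainTheorem1 {U X Y : Type*}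
    [NormedAddCommGroup U] [NormedSpace ℝ U] [FiniteDimensional ℝ U]
    [NormedAddCommGroup X] [NormedSpace ℝ X] [FiniteDimensional ℝ X]
    [NormedAddCommGroup Y] [NormedSpace ℝ Y] [FiniteDimensional ℝ Y]
    (σ : SignalSetting)
    (C : X →ₗ[ℝ] Y) (A : X →ₗ[ℝ] X) (B : U →ₗ[ℝ] X)
    (hctrl : IsControllable A B) (hobs : IsObservable C A)
    (hli : LeftInvertible σ C A B 0)
    (hwor : WeaklyOutputRedundant U C) :
    ∃ S : Submodule ℝ X,
      IsInfimalUnobservabilitySubspace C A (LinearMap.range B) S ∧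
      ∃ 𝓓 : Submodule ℝ Y,
        𝓓 ≠ ⊥ ∧ 𝓓 ≤ S.map C ∧ LeftInvertibleAggregate σ C A B 𝓓 := by
  rw [leftInvertible_iff_discrete] at hli
  obtain ⟨S, hS⟩ := exists_isInfimalUnobservabilitySubspace C A (LinearMap.range B)
  refine ⟨S, hS, ?_⟩
  set W := (minConditionedInvariant C A (LinearMap.range B)).map C
  have hWS : W ≤ S.map C := Submodule.map_mono (hS.1.1.minConditionedInvariant_le hS.1.2)
  -- Exactly `dim U` directions: enough for a single impulse to force a dependence, and too few to
  -- span `Y`.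
  obtain ⟨d', hd'⟩ := exists_linearIndependent_of_le_finrank hli.finrank_le_finrank_map
  have hd : LinearIndependent ℝ fun i => (d' i : Y) := hd'.map' W.subtype W.ker_subtype
  by_contra! hno
  have hresp : ∀ i, ∃ (v : ℕ → U) (s : ℕ → ℝ), (∃ k, s k ≠ 0) ∧
      ∀ k, C (discreteState A B v k) = s k • (d' i : Y) := fun i => by
    refine exists_response_of_not_leftInvertibleAggregate hli fun h => ?_
    refine hno (Submodule.span ℝ {(d' i : Y)}) ?_ ?_ ((leftInvertible_iff_discrete σ).2 h)
    · rw [Ne, Submodule.span_singleton_eq_bot]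
      exact hd.ne_zero i
    · rw [Submodule.span_singleton_le_iff_mem]
      exact hWS (d' i).2
  choose v s hs hy using hresp
  have hrange : LinearMap.range C ≤ Submodule.span ℝ (Set.range fun i => (d' i : Y)) := by
    rintro _ ⟨x, rfl⟩
    exact hctrl.map_mem_of_markov_mem (markov_mem_span hd hs hy) x
  have h1 := Submodule.finrank_mono hrange
  rw [finrank_span_eq_card hd, Fintype.card_fin, hwor.2] at h1
  exact absurd hwor.1 (not_lt.2 h1)
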